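/- Let $\mathbb{T}$ be the $3$-regular tree with root $\varnothing$, whose vertices are labelled by words: the root has children $1,2,3$, and every other vertex $x$ has children $x1,x2$. For $n\ge 1$ let $1_n=1\cdots1$ ($n$ letters), a vertex at distance $n$ from $\varnothing$. Let $\mathbb{L}$ be the space of lines (traces of bi-infinite geodesic paths) of $\mathbb{T}$, and let $\mu$ be the automorphism-invariant, locally finite Borel measure on $\mathbb{L}$ normalised by $\mu\{\ell\in\mathbb{L}:x,y\in\ell\}=2^{-d(x,y)}$ for all $x\ne y$ in $\mathbb{T}$. Let $\beta>1$, and let $\Pi$ be a Poisson process on $\mathbb{L}\times(0,\infty)$ with intensity $(\beta-1)\cdot\mu\otimes v^{-\beta}\,\mathrm{d}v$; an atom $(\ell,v)$ of $\Pi$ is a road with speed limit $v$ on the line $\ell$. For each edge $e$ of $\mathbb{T}$ let $V_e$ be the speed of the fastest road of $\Pi$ that passes through $e$, and for vertices $x,y$ let $T(x,y)=\sum_e V_e^{-1}$, the sum being over the edges of the geodesic path between $x$ and $y$. For all integers $n\ge 1$ and all real $t>0$, $$\mathbb{P}\big(T(\varnothing,1_n)\le t\big)\le 2^{-n}\Big(\frac{t}{n}\Big)^{\beta-1}\exp\Big[\sum_{k=1}^{n-1}\frac{k+1}{k^{\beta-1}}\,t^{\beta-1}\Big].$$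 On the other hand, one has the trivial lower bound $$\mathbb{P}\big(T(\varnothing,1_n)\le t\big)\ge 1-\exp\Big[-2^{-n}\Big(\frac{t}{n}\Big)^{\beta-1}\Big]$$ for all $n\ge1$ and $t>0$. If $\beta>3$, the two bounds match up to constants: for every fixed $t>0$, $$\mathbb{P}\big(T(\varnothing,1_n)\le t\big)=\Theta\Big(2^{-n}\Big(\frac{t}{n}\Big)^{\beta-1}\Big)\quad\text{as } n\to\infty.$$ -/

import Mathlib

open MeasureTheory ProbabilityTheory
open scoped ENNReal

noncomputable section

namespace RoadTree

/-! ### The 3-regular tree -/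

/-- Vertices of the rooted 3-regular tree. Apart from the root, a vertex is a word: a first label
`i` in a 3-element set, followed by labels in a 2-element set, the list `w` of the latter being
written with the last label first. So the children of `branch i w` are the `branch i (j :: w)`. -/
inductive Vertex
  | root : Vertex
  | branch (i : Fin 3) (w : List (Fin 2)) : Vertex

namespace Vertex

/-- The parent of a vertex: erase its last label (and `root` is sent to itself). -/
def parent : Vertex → Vertex
  | root => root
  | branch _ [] => root
  | branch i (_ :: w) => branch i w

/-- The length of the word, i.e. the distance to the root. -/
def depth : Vertex → ℕ
  | root => 0
  | branch _ w => w.length + 1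

/-- The vertex `1 ⋯ 1` (`n` letters): every label is the first one. -/
def ones : ℕ → Vertex
  | 0 => root
  | n + 1 => branch 0 (List.replicate n 0)

theorem depth_parent (v : Vertex) : v.parent.depth = v.depth - 1 := by
  match v with
  | root => rfl
  | branch _ [] => rfl
  | branch _ (_ :: _) => rfl

theorem depth_pos {v : Vertex} (h : v ≠ root) : 0 < v.depth := by
  match v with
  | root => exact absurd rfl h
  | branch _ _ => exact Nat.succ_pos _

theorem depth_iterate_parent (k : ℕ) (v : Vertex) : (parent^[k] v).depth = v.depth - k := by
  induction k with
  | zero => simp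
  | succ k ih => rw [Function.iterate_succ_apply', depth_parent, ih]; omega

end Vertex

open Vertex

/-- The 3-regular tree: each vertex other than the root is joined to its parent. -/
def tree : SimpleGraph Vertex := SimpleGraph.fromRel fun x y => y.parent = x

theorem adj_parent {v : Vertex} (h : v ≠ root) : tree.Adj v.parent v := by
  refine (SimpleGraph.fromRel_adj _ _ _).2 ⟨fun he => ?_, Or.inl rfl⟩
  have h1 := depth_parent v
  have h2 := depth_pos h
  rw [he] at h1
  omega

theorem adj_cases {x y : Vertex} (h : tree.Adj x y) :
    (y.parent = x ∧ y ≠ root) ∨ (x.parent = y ∧ x ≠ root) := by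
  obtain ⟨hne, h | h⟩ := (SimpleGraph.fromRel_adj _ _ _).1 h
  · exact Or.inl ⟨h, fun hy => hne (by rw [← h, hy]; rfl)⟩
  · exact Or.inr ⟨h, fun hx => hne (by rw [← h, hx]; rfl)⟩

theorem tree_reachable_root (v : Vertex) : tree.Reachable root v := by
  induction hd : v.depth generalizing v with
  | zero =>
    match v with
    | root => exact SimpleGraph.Reachable.refl _
    | branch _ _ => exact absurd hd (Nat.succ_ne_zero _)
  | succ n ih =>
    have hv : v ≠ root := fun h => by rw [h] at hd; exact absurd hd (Nat.succ_ne_zero _).symm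
    exact (ih v.parent (by rw [depth_parent, hd]; rfl)).trans (adj_parent hv).reachable

theorem tree_connected : tree.Connected where
  preconnected u v := (tree_reachable_root u).symm.trans (tree_reachable_root v)
  nonempty := ⟨root⟩

/-- The geodesic path between two vertices. -/
def geodesic (x y : Vertex) : tree.Walk x y :=
  (tree_connected.exists_walk_length_eq_dist x y).choose

/-! ### Lines, rays, and the line joining two rays -/

/-- A set of vertices is a line when it is the trace of a bi-infinite geodesic path. -/
def IsLine (s : Set Vertex) : Prop :=
  ∃ γ : ℤ → Vertex, (∀ m n : ℤ, tree.dist (γ m) (γ n) = (m - n).natAbs) ∧ s = Set.range γ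

/-- The space of lines of the tree. -/
def Line : Type := {s : Set Vertex // IsLine s}

/-- Rays, i.e. infinite non-backtracking paths from the root, given by their successive labels,
with the product topology and the product σ-algebra. -/
abbrev Ray : Type := Fin 3 × (ℕ → Fin 2)

/-- The list of the first `n` terms of `b`, last term first. -/
def initialWord (b : ℕ → Fin 2) : ℕ → List (Fin 2)
  | 0 => []
  | n + 1 => b n :: initialWord b n

/-- The `n`-th vertex of a ray. -/
def Ray.vertex (ξ : Ray) : ℕ → Vertex
  | 0 => root
  | n + 1 => branch ξ.1 (initialWord ξ.2 n)

/-- The depth of the farthest vertex from the root that is common to two distinct rays. -/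
def meetDepth (ξ η : Ray) : ℕ := sSup {n | ξ.vertex n = η.vertex n}

/-- The distance on the boundary of the tree. -/
def rayDist (ξ η : Ray) : ℝ :=
  open Classical in if ξ = η then 0 else (1 / 2 : ℝ) ^ meetDepth ξ η

/-- The trace of the path that comes from `η` up to the farthest common vertex, and then
follows `ξ`. -/
def joinSet (ξ η : Ray) : Set Vertex :=
  {v | ∃ m, meetDepth ξ η ≤ m ∧ (v = ξ.vertex m ∨ v = η.vertex m)}

theorem parent_vertex (ξ : Ray) (n : ℕ) : (ξ.vertex n).parent = ξ.vertex (n - 1) := by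
  match n with
  | 0 => rfl
  | 1 => rfl
  | _ + 2 => rfl

theorem length_initialWord (b : ℕ → Fin 2) (n : ℕ) : (initialWord b n).length = n := by
  induction n with
  | zero => rfl
  | succ n ih => simp [initialWord, ih]

theorem depth_vertex (ξ : Ray) (n : ℕ) : (ξ.vertex n).depth = n := by
  match n with
  | 0 => rfl
  | n + 1 => simp [Ray.vertex, depth, length_initialWord]

theorem vertex_ne_root (ξ : Ray) {n : ℕ} (hn : n ≠ 0) : ξ.vertex n ≠ root := fun h => by
  have := depth_vertex ξ n
  rw [h] at this
  exact hn this.symm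

theorem iterate_parent_vertex (ξ : Ray) (k n : ℕ) :
    parent^[k] (ξ.vertex n) = ξ.vertex (n - k) := by
  induction k with
  | zero => rfl
  | succ k ih => rw [Function.iterate_succ_apply', ih, parent_vertex]; rfl

theorem exists_vertex_ne {ξ η : Ray} (h : ξ ≠ η) : ∃ n, ξ.vertex n ≠ η.vertex n := by
  by_contra! hc
  apply h
  refine Prod.ext ?_ (funext fun n => ?_)
  · have := hc 1
    simp only [Ray.vertex, Vertex.branch.injEq] at this
    exact this.1
  · have := hc (n + 2)
    simp only [Ray.vertex, initialWord, Vertex.branch.injEq, List.cons.injEq] at this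
    exact this.2.1

theorem vertex_eq_of_le {ξ η : Ray} {m n : ℕ} (hmn : m ≤ n) (h : ξ.vertex n = η.vertex n) :
    ξ.vertex m = η.vertex m := by
  have := congrArg parent^[n - m] h
  rw [iterate_parent_vertex, iterate_parent_vertex, Nat.sub_sub_self hmn] at this
  exact this

theorem vertex_eq_iff {ξ η : Ray} (h : ξ ≠ η) (n : ℕ) :
    ξ.vertex n = η.vertex n ↔ n ≤ meetDepth ξ η := by
  obtain ⟨N, hN⟩ := exists_vertex_ne h
  have hb : BddAbove {n | ξ.vertex n = η.vertex n} :=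
    ⟨N, fun n hn => by
      by_contra hlt
      exact hN (vertex_eq_of_le (by omega) hn)⟩
  refine ⟨fun hn => le_csSup hb hn, fun hn => vertex_eq_of_le hn ?_⟩
  exact Nat.sSup_mem (s := {n | ξ.vertex n = η.vertex n}) ⟨0, rfl⟩ hb

theorem abs_sub_le_walk_length {f : Vertex → ℤ} (hf : ∀ x y, tree.Adj x y → |f x - f y| ≤ 1)
    {x y : Vertex} (p : tree.Walk x y) : |f x - f y| ≤ p.length := by
  induction p with
  | nil => simp
  | cons h p ih =>
    rename_i u v w
    rw [SimpleGraph.Walk.length_cons]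
    have h1 := hf _ _ h
    have h2 := abs_sub_le (f u) (f v) (f w)
    push_cast
    linarith

/-- A path along which some 1-Lipschitz function grows with unit speed is geodesic. -/
theorem dist_eq_of_lipschitz {γ : ℤ → Vertex} (hγ : ∀ k, tree.Adj (γ k) (γ (k + 1)))
    {f : Vertex → ℤ} (hf : ∀ x y, tree.Adj x y → |f x - f y| ≤ 1) (hfγ : ∀ k, f (γ k) = k)
    (m n : ℤ) : tree.dist (γ m) (γ n) = (m - n).natAbs := by
  have up : ∀ (k : ℤ) (j : ℕ), tree.dist (γ k) (γ (k + j)) ≤ j := by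
    intro k j
    induction j with
    | zero => simp
    | succ j ih =>
      have h1 := tree_connected.dist_triangle (u := γ k) (v := γ (k + j)) (w := γ (k + j + 1))
      have h2 := SimpleGraph.dist_eq_one_iff_adj.2 (hγ (k + j))
      rw [Nat.cast_succ, ← add_assoc]
      omega
  have le : tree.dist (γ m) (γ n) ≤ (m - n).natAbs := by
    rcases le_total m n with h | h
    · have := up m (n - m).natAbs
      rw [show m + ((n - m).natAbs : ℤ) = n by omega] at this
      omega
    · have := up n (m - n).natAbs
      rw [show n + ((m - n).natAbs : ℤ) = m by omega, SimpleGraph.dist_comm] at this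
      exact this
  refine le_antisymm le ?_
  obtain ⟨p, hp⟩ := tree_connected.exists_walk_length_eq_dist (γ m) (γ n)
  have := abs_sub_le_walk_length hf p
  rw [hfγ, hfγ, hp, abs_le] at this
  omega

theorem adj_vertex_succ (ξ : Ray) (n : ℕ) : tree.Adj (ξ.vertex n) (ξ.vertex (n + 1)) := by
  have := adj_parent (vertex_ne_root ξ (Nat.succ_ne_zero n))
  rwa [parent_vertex] at this

theorem isLine_joinSet {ξ η : Ray} (h : ξ ≠ η) : IsLine (joinSet ξ η) := by
  classical
  set N := meetDepth ξ η with hN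
  have hmeet := vertex_eq_iff h
  let γ : ℤ → Vertex := fun k => if 0 ≤ k then ξ.vertex (N + k.natAbs) else η.vertex (N + k.natAbs)
  have hγpos : ∀ k : ℕ, γ k = ξ.vertex (N + k) := fun k => by simp [γ]
  have hγneg : ∀ k : ℕ, γ (-k) = η.vertex (N + k) := fun k => by
    rcases Nat.eq_zero_or_pos k with rfl | hk
    · simpa [γ] using (hmeet N).2 le_rfl
    · have : ¬ (0 : ℤ) ≤ -k := by omega
      simp only [γ, this, if_false, Int.natAbs_neg, Int.natAbs_natCast]
  let z := ξ.vertex (N + 1)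
  have hz : z.depth = N + 1 := depth_vertex _ _
  let D : Vertex → Prop := fun v => ∃ k, parent^[k] v = z
  let f : Vertex → ℤ := fun v => if D v then (v.depth : ℤ) - N else N - v.depth
  have hDparent : ∀ v, v ≠ z → (D v.parent ↔ D v) := by
    intro v hv
    constructor
    · rintro ⟨k, hk⟩
      exact ⟨k + 1, hk⟩
    · rintro ⟨k, hk⟩
      cases k with
      | zero => exact absurd hk hv
      | succ k => exact ⟨k, hk⟩
  have hDz : D z := ⟨0, rfl⟩
  have hDpz : ¬ D z.parent := by
    rintro ⟨k, hk⟩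
    have h1 := depth_iterate_parent k z.parent
    rw [hk, depth_parent, hz] at h1
    omega
  have hstep : ∀ v, v ≠ root → |f v.parent - f v| ≤ 1 := by
    intro v hv
    have h1 := depth_parent v
    have h2 := depth_pos hv
    by_cases hvz : v = z
    · subst hvz
      simp only [f, hDz, hDpz, if_true, if_false, h1, hz]
      rw [abs_le]
      omega
    · simp only [f, hDparent v hvz]
      split_ifs <;> rw [abs_le] <;> omega
  have hf : ∀ x y, tree.Adj x y → |f x - f y| ≤ 1 := by
    intro x y hxy
    rcases adj_cases hxy with ⟨rfl, hy⟩ | ⟨rfl, hx⟩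
    · exact hstep y hy
    · rw [abs_sub_comm]
      exact hstep x hx
  have hDη : ∀ m, ¬ D (η.vertex m) := by
    rintro m ⟨k, hk⟩
    rw [iterate_parent_vertex] at hk
    have h1 : m - k = N + 1 := by
      rw [← depth_vertex η (m - k), hk, hz]
    rw [h1] at hk
    have := (hmeet (N + 1)).1 hk.symm
    omega
  have hfγ : ∀ k, f (γ k) = k := by
    intro k
    rcases Int.eq_nat_or_neg k with ⟨j, rfl | rfl⟩
    · rw [hγpos]
      rcases Nat.eq_zero_or_pos j with rfl | hj
      · have h0 : ξ.vertex (N + 0) = η.vertex (N + 0) := (hmeet _).2 le_rfl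
        rw [h0]
        simp only [f, hDη, if_false, depth_vertex]
        simp
      · have hD : D (ξ.vertex (N + j)) := by
          refine ⟨j - 1, ?_⟩
          rw [iterate_parent_vertex, show N + j - (j - 1) = N + 1 by omega]
        simp only [f, hD, if_true, depth_vertex]
        push_cast
        ring
    · rw [hγneg]
      simp only [f, hDη, if_false, depth_vertex]
      push_cast
      ring
  have hγ : ∀ k, tree.Adj (γ k) (γ (k + 1)) := by
    intro k
    rcases Int.eq_nat_or_neg k with ⟨j, rfl | rfl⟩
    · rw [hγpos, show ((j : ℤ) + 1) = ((j + 1 : ℕ) : ℤ) by push_cast; rfl, hγpos]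
      exact adj_vertex_succ ξ (N + j)
    · cases j with
      | zero =>
        rw [show (-((0 : ℕ) : ℤ)) = ((0 : ℕ) : ℤ) by simp, hγpos,
          show (((0 : ℕ) : ℤ) + 1) = ((1 : ℕ) : ℤ) by simp, hγpos]
        exact adj_vertex_succ ξ N
      | succ j =>
        rw [hγneg, show -((j + 1 : ℕ) : ℤ) + 1 = -(j : ℤ) by push_cast; ring, hγneg]
        exact (adj_vertex_succ η (N + j)).symm
  refine ⟨γ, dist_eq_of_lipschitz hγ hf hfγ, ?_⟩
  ext v
  constructor
  · rintro ⟨m, hm, rfl | rfl⟩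
    · exact ⟨((m - N : ℕ) : ℤ), by rw [hγpos, Nat.add_sub_cancel' hm]⟩
    · exact ⟨-((m - N : ℕ) : ℤ), by rw [hγneg, Nat.add_sub_cancel' hm]⟩
  · rintro ⟨k, rfl⟩
    rcases Int.eq_nat_or_neg k with ⟨j, rfl | rfl⟩
    · exact ⟨N + j, Nat.le_add_right _ _, Or.inl (hγpos j)⟩
    · exact ⟨N + j, Nat.le_add_right _ _, Or.inr (hγneg j)⟩

/-- Ordered pairs of distinct rays. -/
abbrev RayPair : Type := {p : Ray × Ray // p.1 ≠ p.2}

/-- The line whose endpoints are two distinct rays. -/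
def lineOfRays (p : RayPair) : Line := ⟨joinSet p.1.1 p.1.2, isLine_joinSet p.2⟩

/-- The space of lines has the final topology for `lineOfRays`. -/
instance : TopologicalSpace Line := TopologicalSpace.coinduced lineOfRays inferInstance

instance : MeasurableSpace Line := borel Line

instance : BorelSpace Line := ⟨rfl⟩

/-! ### The invariant measure on the space of lines -/

/-- The law of the non-backtracking random walk started at the root: the first label is uniform
among three, the next ones are uniform among two, and all labels are independent. -/
def rayLaw : Measure Ray :=
  (uniformOn (Set.univ : Set (Fin 3))).prod
    (Measure.infinitePi fun _ : ℕ => uniformOn (Set.univ : Set (Fin 2)))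

/-- The invariant measure on lines: the image by `lineOfRays` of the measure
`rayDist ξ η ^ (-2)` times the law of two independent non-backtracking random walks, multiplied by
`9 / 8`, so that the set of lines through `x` and `y` has measure `2 ^ (-d(x, y))` for `x ≠ y`. -/
def lineMeasure : Measure Line :=
  (9 / 8 : ℝ≥0∞) •
    ((((rayLaw.prod rayLaw).comap ((↑) : RayPair → Ray × Ray)).withDensity
      fun p => ENNReal.ofReal (1 / rayDist p.1.1 p.1.2 ^ 2)).map lineOfRays)

/-! ### Roads and the Poisson process of roads -/

/-- Speeds: positive reals. -/
abbrev Speed : Type := Set.Ioi (0 : ℝ)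

/-- A road: a line and the speed limit on it. -/
abbrev Road : Type := Line × Speed

/-- The measure `v ^ (-β) dv` on positive reals. -/
def speedMeasure (β : ℝ) : Measure Speed :=
  ((volume : Measure ℝ).comap ((↑) : Speed → ℝ)).withDensity
    fun v => ENNReal.ofReal ((v : ℝ) ^ (-β))

/-- The intensity `(β - 1) · μ ⊗ v ^ (-β) dv`. -/
def roadIntensity (β : ℝ) : Measure Road :=
  ENNReal.ofReal (β - 1) • lineMeasure.prod (speedMeasure β)

/-- The law of a Poisson variable with parameter `a ∈ [0, ∞]`, with values in `{0, 1, …, ∞}`;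
it is the constant `∞` when `a = ∞`. -/
def poissonLaw (a : ℝ≥0∞) : Measure ℕ∞ :=
  if a = ∞ then Measure.dirac ⊤ else (poissonMeasure a.toNNReal).map ((↑) : ℕ → ℕ∞)

/-- A random set `Ξ` of points is a (simple) Poisson process with intensity `ν` when the numbers of
points in measurable sets are random variables with Poisson laws of parameters given by `ν`, and are
independent for pairwise disjoint sets. -/
structure IsPoissonProcess {Ω X : Type*} [MeasurableSpace Ω] [MeasurableSpace X]
    (P : Measure Ω) (ν : Measure X) (Ξ : Ω → Set X) : Prop where
  measurable_count : ∀ B : Set X, MeasurableSet B → Measurable fun ω => (Ξ ω ∩ B).encard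
  map_count : ∀ B : Set X, MeasurableSet B →
    P.map (fun ω => (Ξ ω ∩ B).encard) = poissonLaw (ν B)
  indep_count : ∀ (k : ℕ) (B : Fin k → Set X), (∀ i, MeasurableSet (B i)) →
    Pairwise (Function.onFun Disjoint B) → iIndepFun (fun i ω => (Ξ ω ∩ B i).encard) P

/-! ### The driving distance -/

/-- The speed of the fastest road of the set `π` that passes through both `x` and `y`. -/
def fastestSpeed (π : Set Road) (x y : Vertex) : ℝ≥0∞ :=
  ⨆ r ∈ {r ∈ π | x ∈ r.1.1 ∧ y ∈ r.1.1}, ENNReal.ofReal (r.2 : ℝ)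

/-- The driving distance: the sum of the inverses of the speeds of the fastest roads through the
edges of the geodesic path between `x` and `y`. -/
def drivingDist (π : Set Road) (x y : Vertex) : ℝ≥0∞ :=
  ((geodesic x y).darts.map fun e => (fastestSpeed π e.fst e.snd)⁻¹).sum

end RoadTree

end

namespace RoadTree

/-! ### Poisson processes -/

/-! Upper bound. Let the driving time be at most `t`, and let `s > t`. Every nonempty set `U` of
edges of the segment has an edge with a road faster than `U.card / s`, since otherwise `U` alone
would cost at least `s`. Start with `U` equal to all `n` edges, choose such a road, remove from `U`
the interval spanned by the edges of `U` on that road, and repeat until `U` is empty. A road chosen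
later passes through an edge that the earlier ones miss, so the roads are distinct, and the
probability of finding distinct Poisson points in prescribed sets is at most the product of the
intensities (`measure_exists_injective_le`).

Roads faster than `u` through a segment of `l` edges have intensity `2 ^ (-l) * u ^ (1 - β)`
(`lineMeasure_through`, `roadIntensity_fastRoads`). The removed intervals together contain all `n`
edges, so the powers of `1 / 2` contribute at most `2 ^ (-n)`. At most `k + 1` intervals leave `k`
edges, hence with `x k = (s / k) ^ (β - 1)` the total weight `W r` of the removals from `r` edges is
governed by `W 0 = 1` and `W r = x r * ∑ k < r, (k + 1) * W k`. This is solved by `W r = x r * ∏ (1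
+ (k + 1) * x k)` over `1 ≤ k < r`. The inequality `1 + y ≤ exp y` and the limit `s ↓ t` conclude.

Lower bound. It suffices that one road faster than `n / t` passes through the whole segment, and the
number of such roads is Poisson.

If `β > 3`, the sum in the exponential converges, and `1 - exp (-x)` is comparable to `x` for
bounded `x`. -/

theorem poissonMeasure_Ici_le (r : NNReal) (m : ℕ) :
    poissonMeasure r (Set.Ici m) ≤ (r : ℝ≥0∞) ^ m := by
  have hsub : Set.Ici m ⊆ ⋃ k : ℕ, {k + m} := fun n hn =>
    Set.mem_iUnion.2 ⟨n - m, by simp [Nat.sub_add_cancel (Set.mem_Ici.1 hn)]⟩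
  have hone : ∑' k : ℕ, poissonMeasure r {k} = 1 := by
    rw [← measure_iUnion (fun i j hij => Set.disjoint_singleton.2 hij)
      (fun i => measurableSet_singleton i), Set.iUnion_of_singleton, measure_univ]
  calc poissonMeasure r (Set.Ici m)
      ≤ ∑' k : ℕ, poissonMeasure r {k + m} := (measure_mono hsub).trans (measure_iUnion_le _)
    _ ≤ ∑' k : ℕ, (r : ℝ≥0∞) ^ m * poissonMeasure r {k} := by
        refine ENNReal.tsum_le_tsum fun k => ?_
        have h1 : (r : ℝ≥0∞) ^ m = ENNReal.ofReal ((r : ℝ) ^ m) := by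
          rw [ENNReal.ofReal_pow r.coe_nonneg, ENNReal.ofReal_coe_nnreal]
        rw [poissonMeasure_singleton, poissonMeasure_singleton, h1,
          ← ENNReal.ofReal_mul (by positivity)]
        refine ENNReal.ofReal_le_ofReal ?_
        -- Replacing `(k + m)!` by `k!` splits off the factor `r ^ m` and leaves the Poisson
        -- weights, of total mass 1.
        have h2 : ((k.factorial : ℕ) : ℝ) ≤ ((k + m).factorial : ℕ) := by
          exact_mod_cast Nat.factorial_le (Nat.le_add_right k m)
        have h3 : (0 : ℝ) < k.factorial := by exact_mod_cast k.factorial_pos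
        calc Real.exp (-r) * (r : ℝ) ^ (k + m) / ((k + m).factorial : ℕ)
            ≤ Real.exp (-r) * (r : ℝ) ^ (k + m) / (k.factorial : ℕ) := by gcongr
          _ = (r : ℝ) ^ m * (Real.exp (-r) * (r : ℝ) ^ k / (k.factorial : ℕ)) := by ring
    _ = (r : ℝ≥0∞) ^ m := by rw [ENNReal.tsum_mul_left, hone, mul_one]

theorem poissonLaw_Ici_le (a : ℝ≥0∞) (m : ℕ) : poissonLaw a (Set.Ici (m : ℕ∞)) ≤ a ^ m := by
  unfold poissonLaw
  split_ifs with ha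
  · rw [Measure.dirac_apply' _ MeasurableSet.of_discrete, Set.indicator_of_mem (by simp), ha]
    rcases Nat.eq_zero_or_pos m with rfl | hm
    · simp
    · rw [ENNReal.top_pow hm.ne']
      exact le_top
  · rw [Measure.map_apply .of_discrete MeasurableSet.of_discrete]
    have h1 : ((↑) : ℕ → ℕ∞) ⁻¹' Set.Ici (m : ℕ∞) = Set.Ici m := by ext; simp
    rw [h1]
    refine (poissonMeasure_Ici_le _ m).trans_eq ?_
    rw [ENNReal.coe_toNNReal ha]

theorem poissonLaw_singleton_zero {a : ℝ≥0∞} (ha : a ≠ ∞) :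
    poissonLaw a {0} = ENNReal.ofReal (Real.exp (-a.toReal)) := by
  rw [poissonLaw, if_neg ha, Measure.map_apply .of_discrete (measurableSet_singleton _)]
  have h1 : ((↑) : ℕ → ℕ∞) ⁻¹' {0} = {0} := by ext; simp
  rw [h1, poissonMeasure_singleton]
  simp [ENNReal.coe_toNNReal_eq_toReal]

section PoissonProcess

variable {Ω X : Type*} [MeasurableSpace Ω] [MeasurableSpace X] {P : Measure Ω} {ν : Measure X}
  {Ξ : Ω → Set X}

theorem IsPoissonProcess.measure_le_encard_le (h : IsPoissonProcess P ν Ξ) {B : Set X}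
    (hB : MeasurableSet B) (m : ℕ) : P {ω | (m : ℕ∞) ≤ (Ξ ω ∩ B).encard} ≤ ν B ^ m := by
  have := poissonLaw_Ici_le (ν B) m
  rwa [← h.map_count B hB, Measure.map_apply (h.measurable_count B hB) MeasurableSet.of_discrete] at this

theorem IsPoissonProcess.measure_inter_eq_empty (h : IsPoissonProcess P ν Ξ) {B : Set X}
    (hB : MeasurableSet B) (hν : ν B ≠ ∞) :
    P {ω | Ξ ω ∩ B = ∅} = ENNReal.ofReal (Real.exp (-(ν B).toReal)) := by
  rw [← poissonLaw_singleton_zero hν, ← h.map_count B hB,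
    Measure.map_apply (h.measurable_count B hB) (measurableSet_singleton _)]
  congr 1
  ext ω
  simp

theorem IsPoissonProcess.measurableSet_inter_eq_empty (h : IsPoissonProcess P ν Ξ) {B : Set X}
    (hB : MeasurableSet B) : MeasurableSet {ω | Ξ ω ∩ B = ∅} := by
  have := h.measurable_count B hB (measurableSet_singleton 0)
  convert this using 1
  ext ω
  simp

/-- Independence over disjoint sets. A general finite index type is allowed because the index set
will be the subsets of `Fin m`. -/
theorem IsPoissonProcess.measure_iInter_le_encard_le (h : IsPoissonProcess P ν Ξ) {ι : Type*}
    [Fintype ι] {B : ι → Set X} (hB : ∀ i, MeasurableSet (B i))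
    (hd : Pairwise (Function.onFun Disjoint B)) (m : ι → ℕ) :
    P (⋂ i, {ω | (m i : ℕ∞) ≤ (Ξ ω ∩ B i).encard}) ≤ ∏ i, ν (B i) ^ m i := by
  let e := Fintype.equivFin ι
  have hi := h.indep_count (Fintype.card ι) (fun i => B (e.symm i)) (fun i => hB _)
    (fun i j hij => hd (e.symm.injective.ne hij))
  have key := hi.measure_inter_preimage_eq_mul Finset.univ
    (sets := fun i => Set.Ici (m (e.symm i) : ℕ∞)) (fun i _ => MeasurableSet.of_discrete)
  calc P (⋂ i, {ω | (m i : ℕ∞) ≤ (Ξ ω ∩ B i).encard})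
      ≤ P (⋂ i ∈ Finset.univ, (fun ω => (Ξ ω ∩ B (e.symm i)).encard) ⁻¹'
          Set.Ici (m (e.symm i) : ℕ∞)) := by
        refine measure_mono fun ω hω => ?_
        simp only [Set.mem_iInter, Set.mem_preimage, Set.mem_Ici] at hω ⊢
        exact fun i _ => hω _
    _ = ∏ i, P ((fun ω => (Ξ ω ∩ B (e.symm i)).encard) ⁻¹' Set.Ici (m (e.symm i) : ℕ∞)) := key
    _ ≤ ∏ i, ν (B (e.symm i)) ^ m (e.symm i) :=
        Finset.prod_le_prod' fun i _ => h.measure_le_encard_le (hB _) _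
    _ = ∏ i, ν (B i) ^ m i := e.symm.prod_comp fun i => ν (B i) ^ m i

/-- A union bound for factorial moments: the probability that a Poisson process has distinct points
in prescribed (possibly overlapping) sets is at most the product of their intensities. -/
theorem IsPoissonProcess.measure_exists_injective_le (h : IsPoissonProcess P ν Ξ) {m : ℕ}
    {A : Fin m → Set X} (hA : ∀ i, MeasurableSet (A i)) :
    P {ω | ∃ x : Fin m → X, Function.Injective x ∧ ∀ i, x i ∈ Ξ ω ∩ A i} ≤ ∏ i, ν (A i) := by
  classical
  -- The atoms of the partition generated by the sets `A i`. They are disjoint, so the counts in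
  -- them are independent, and each `A i` is the union of the atoms `B σ` with `i ∈ σ`.
  let B : Finset (Fin m) → Set X := fun σ => {x | ∀ i, x ∈ A i ↔ i ∈ σ}
  have hB : ∀ σ, MeasurableSet (B σ) := by
    intro σ
    have : B σ = ⋂ i, {x | x ∈ A i ↔ i ∈ σ} := by ext; simp [B]
    rw [this]
    refine MeasurableSet.iInter fun i => ?_
    by_cases hi : i ∈ σ
    · simpa [hi] using hA i
    · have : {x | x ∈ A i ↔ i ∈ σ} = (A i)ᶜ := by ext; simp [hi]
      exact this ▸ (hA i).compl
  have hd : Pairwise (Function.onFun Disjoint B) := by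
    intro σ τ hστ
    refine Set.disjoint_left.2 fun x hx hx' => hστ ?_
    ext i
    rw [← hx i, hx' i]
  have hsum : ∀ i, ν (A i) = ∑ σ ∈ Finset.univ.filter (fun σ => i ∈ σ), ν (B σ) := by
    intro i
    rw [← measure_biUnion_finset (fun σ _ τ _ hστ => hd hστ) (fun σ _ => hB σ)]
    congr 1
    ext x
    simp only [Finset.mem_filter, Finset.mem_univ, true_and, Set.mem_iUnion, exists_prop]
    constructor
    · intro hx
      exact ⟨Finset.univ.filter fun j => x ∈ A j, by simpa using hx, fun j => by simp⟩
    · rintro ⟨σ, hi, hx⟩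
      exact (hx i).2 hi
  let F : Finset (Fin m → Finset (Fin m)) :=
    Fintype.piFinset fun i => Finset.univ.filter (fun σ => i ∈ σ)
  -- Let `f i` be the index of the atom containing `x i`. Since the points are distinct, the atom `B
  -- σ` contains at least as many points as the fibre of `f` over `σ` has elements.
  have hsub : {ω | ∃ x : Fin m → X, Function.Injective x ∧ ∀ i, x i ∈ Ξ ω ∩ A i} ⊆
      ⋃ f ∈ F, ⋂ σ, {ω | (((Finset.univ.filter fun i => f i = σ).card : ℕ) : ℕ∞) ≤
        (Ξ ω ∩ B σ).encard} := by
    rintro ω ⟨x, hinj, hx⟩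
    let f : Fin m → Finset (Fin m) := fun i => Finset.univ.filter fun j => x i ∈ A j
    refine Set.mem_biUnion (x := f) ?_ ?_
    · simpa [F, f, Fintype.mem_piFinset] using fun i => (hx i).2
    · simp only [Set.mem_iInter, Set.mem_ofPred_eq]
      intro σ
      rw [← Set.encard_coe_eq_coe_finsetCard, ← hinj.encard_image]
      refine Set.encard_le_encard ?_
      rintro _ ⟨i, hi, rfl⟩
      have hi' : f i = σ := by simpa using hi
      exact ⟨(hx i).1, fun j => by rw [← hi']; simp [f]⟩
  calc P {ω | ∃ x : Fin m → X, Function.Injective x ∧ ∀ i, x i ∈ Ξ ω ∩ A i}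
      ≤ ∑ f ∈ F, P (⋂ σ, {ω | (((Finset.univ.filter fun i => f i = σ).card : ℕ) : ℕ∞) ≤
        (Ξ ω ∩ B σ).encard}) := (measure_mono hsub).trans (measure_biUnion_finset_le _ _)
    _ ≤ ∑ f ∈ F, ∏ i, ν (B (f i)) := by
        refine Finset.sum_le_sum fun f _ =>
          (h.measure_iInter_le_encard_le hB hd _).trans_eq ?_
        rw [← Finset.prod_fiberwise_of_maps_to (g := f) (t := Finset.univ) (fun _ _ => Finset.mem_univ _)]
        refine Finset.prod_congr rfl fun σ _ => ?_
        rw [Finset.prod_congr rfl (g := fun _ => ν (B σ)), Finset.prod_const]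
        intro i hi
        rw [(Finset.mem_filter.1 hi).2]
    _ = ∏ i, ν (A i) := by
        -- The sum over all `f` is the expansion of the product of the sums `∑ σ ∋ i, ν (B σ)`.
        simp_rw [hsum]
        rw [Finset.prod_univ_sum]

end PoissonProcess

open Vertex

/-! ### Geodesics from the root, and the convexity of lines -/

theorem depth_ones (n : ℕ) : (ones n).depth = n := by
  cases n with
  | zero => rfl
  | succ n => simp [ones, depth]

theorem parent_ones_succ (n : ℕ) : (ones (n + 1)).parent = ones n := by
  cases n <;> rfl

theorem iterate_parent_ones (k n : ℕ) : parent^[k] (ones n) = ones (n - k) := by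
  induction k with
  | zero => rfl
  | succ k ih =>
    rw [Function.iterate_succ_apply', ih, ← Nat.sub_sub]
    cases n - k with
    | zero => rfl
    | succ j => exact parent_ones_succ j

theorem ones_ne_root {n : ℕ} (hn : n ≠ 0) : ones n ≠ root := fun h => by
  have := depth_ones n
  rw [h] at this
  exact hn this.symm

theorem adj_ones_succ (n : ℕ) : tree.Adj (ones n) (ones (n + 1)) := by
  have := adj_parent (ones_ne_root (Nat.succ_ne_zero n))
  rwa [parent_ones_succ] at this

theorem depth_le_depth_add_length {x y : Vertex} (p : tree.Walk x y) :
    y.depth ≤ x.depth + p.length := by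
  have h := abs_sub_le_walk_length (f := fun v => (v.depth : ℤ)) (fun x y hxy => by
    rcases adj_cases hxy with ⟨rfl, hy⟩ | ⟨rfl, hx⟩
    · have := depth_parent y
      have := depth_pos hy
      rw [abs_le]
      omega
    · have := depth_parent x
      have := depth_pos hx
      rw [abs_le]
      omega) p
  rw [abs_le] at h
  omega

/-- A walk along which the depth increases at each step goes through the ancestors of its endpoint. -/
theorem sum_darts_of_length_add_depth {M : Type*} [AddCommMonoid M] (f : Vertex → Vertex → M)
    {x y : Vertex} (p : tree.Walk x y) (hp : p.length + x.depth = y.depth) :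
    (p.darts.map fun e => f e.fst e.snd).sum =
      ∑ k ∈ Finset.range p.length, f (parent^[k + 1] y) (parent^[k] y) ∧
      parent^[p.length] y = x := by
  induction p with
  | nil => simp
  | @cons u w v h p ih =>
    rw [SimpleGraph.Walk.length_cons] at hp
    have h1 := depth_le_depth_add_length p
    have hw : w.parent = u := by
      rcases adj_cases h with ⟨h, -⟩ | ⟨rfl, hu⟩
      · exact h
      · have := depth_parent u
        have := depth_pos hu
        omega
    have hd : w.depth = u.depth + 1 := by
      have := depth_parent w
      rw [hw] at this
      omega
    obtain ⟨ih1, ih2⟩ := ih (by omega)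
    have h2 : parent^[p.length + 1] v = u := by
      rw [Function.iterate_succ_apply', ih2, hw]
    refine ⟨?_, by rw [SimpleGraph.Walk.length_cons, h2]⟩
    rw [SimpleGraph.Walk.darts_cons, List.map_cons, List.sum_cons, ih1,
      SimpleGraph.Walk.length_cons, Finset.sum_range_succ, h2, ih2, add_comm]

theorem dist_root_ones (n : ℕ) : tree.dist root (ones n) = n := by
  refine le_antisymm ?_ ?_
  · induction n with
    | zero => simp [ones]
    | succ n ih =>
      have h1 := tree_connected.dist_triangle (u := root) (v := ones n) (w := ones (n + 1))
      have h2 := SimpleGraph.dist_eq_one_iff_adj.2 (adj_ones_succ n)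
      omega
  · obtain ⟨p, hp⟩ := tree_connected.exists_walk_length_eq_dist root (ones n)
    have := depth_le_depth_add_length p
    rw [depth_ones, hp] at this
    simpa [depth] using this

/-- The chosen `geodesic` is known only to be a shortest walk. Its length equals the depth of its
endpoint, so each step must go down, which determines the walk. -/
theorem drivingDist_root_ones (π : Set Road) (n : ℕ) :
    drivingDist π root (ones n) =
      ∑ k ∈ Finset.range n, (fastestSpeed π (ones k) (ones (k + 1)))⁻¹ := by
  have hl : (geodesic root (ones n)).length = n :=
    (tree_connected.exists_walk_length_eq_dist root (ones n)).choose_spec.trans (dist_root_ones n)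
  have hd := (sum_darts_of_length_add_depth (fun x y => (fastestSpeed π x y)⁻¹)
    (geodesic root (ones n)) (by rw [hl, depth_ones]; rfl)).1
  rw [drivingDist, hd, hl, ← Finset.sum_range_reflect]
  refine Finset.sum_congr rfl fun k hk => ?_
  have hk' := Finset.mem_range.1 hk
  rw [iterate_parent_ones, iterate_parent_ones, show n - (n - 1 - k + 1) = k by omega,
    show n - (n - 1 - k) = k + 1 by omega]

/-- The only edge that leads into the descendants of `z` is the one from the parent of `z`. -/
theorem eq_of_adj_of_descendant {x y z : Vertex} (h : tree.Adj x y)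
    (hx : ¬ ∃ k, parent^[k] x = z) (hy : ∃ k, parent^[k] y = z) : y = z := by
  obtain ⟨k, hk⟩ := hy
  rcases adj_cases h with ⟨rfl, -⟩ | ⟨rfl, -⟩
  · cases k with
    | zero => exact hk
    | succ k => exact absurd ⟨k, hk⟩ hx
  · exact absurd ⟨k + 1, hk⟩ hx

/-- The descendants of `ones j` can be entered or left only through `ones j`. On a line avoiding
`ones j`, being such a descendant would be constant along the line, yet `ones k` is one and `ones i`
is not when `i < j`. -/
theorem ones_mem_of_le {s : Set Vertex} (hs : IsLine s) {i j k : ℕ} (hi : ones i ∈ s)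
    (hk : ones k ∈ s) (hij : i ≤ j) (hjk : j ≤ k) : ones j ∈ s := by
  obtain ⟨γ, hγ, rfl⟩ := hs
  rcases hij.eq_or_lt with rfl | hij
  · exact hi
  by_contra hj
  let D : Vertex → Prop := fun v => ∃ m, parent^[m] v = ones j
  have hadj : ∀ m, tree.Adj (γ m) (γ (m + 1)) := fun m => by
    rw [← SimpleGraph.dist_eq_one_iff_adj, hγ]
    omega
  have hstep : ∀ m, D (γ m) ↔ D (γ (m + 1)) := by
    refine fun m => ⟨fun h => ?_, fun h => ?_⟩
    · by_contra h'
      exact hj ⟨m, eq_of_adj_of_descendant (hadj m).symm h' h⟩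
    · by_contra h'
      exact hj ⟨m + 1, eq_of_adj_of_descendant (hadj m) h' h⟩
  have hall : ∀ m, D (γ m) ↔ D (γ 0) := by
    intro m
    induction m using Int.induction_on with
    | zero => rfl
    | succ m ih => rw [← ih, hstep m]
    | pred m ih => rw [← ih, hstep (-m - 1)]; simp
  obtain ⟨a, ha⟩ := hi
  obtain ⟨b, hb⟩ := hk
  have hDb : D (γ b) := ⟨k - j, by rw [hb, iterate_parent_ones]; congr 1; omega⟩
  have hDa : ¬ D (γ a) := by
    rintro ⟨m, hm⟩
    rw [ha, iterate_parent_ones] at hm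
    have := congrArg depth hm
    rw [depth_ones, depth_ones] at this
    omega
  exact hDa ((hall a).2 ((hall b).1 hDb))

/-! ### The measure of the set of lines through a segment -/

/-- This removes `meetDepth`: membership of `v` depends only on the vertices of the rays at two
fixed depths, hence is a locally constant condition on the pair. -/
theorem mem_joinSet_iff {ξ η : Ray} (h : ξ ≠ η) (v : Vertex) :
    v ∈ joinSet ξ η ↔ ξ.vertex (v.depth + 1) ≠ η.vertex (v.depth + 1) ∧
      (ξ.vertex v.depth = v ∨ η.vertex v.depth = v) := by
  rw [Ne, vertex_eq_iff h]
  constructor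
  · rintro ⟨m, hm, rfl | rfl⟩ <;> rw [depth_vertex] <;> simp <;> omega
  · rintro ⟨hm, hv⟩
    exact ⟨v.depth, by omega, hv.imp Eq.symm Eq.symm⟩

theorem isLocallyConstant_vertex (n : ℕ) : IsLocallyConstant fun ξ : Ray => ξ.vertex n := by
  cases n with
  | zero => exact IsLocallyConstant.const _
  | succ n =>
    have h1 : IsLocallyConstant fun ξ : Ray => ξ.1 :=
      (IsLocallyConstant.iff_continuous _).2 continuous_fst
    have h2 : ∀ n, IsLocallyConstant fun ξ : Ray => initialWord ξ.2 n := by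
      intro n
      induction n with
      | zero => exact IsLocallyConstant.const _
      | succ n ih =>
        have h3 : IsLocallyConstant fun ξ : Ray => ξ.2 n :=
          (IsLocallyConstant.iff_continuous _).2 (by fun_prop)
        exact (h3.prodMk ih).comp fun q => q.1 :: q.2
    exact (h1.prodMk (h2 n)).comp fun q => branch q.1 q.2

theorem isOpen_setOf_mem_line (v : Vertex) : IsOpen {ℓ : Line | v ∈ ℓ.1} := by
  refine isOpen_coinduced.2 ?_
  have h1 : ∀ n, IsLocallyConstant fun p : RayPair => p.1.1.vertex n := fun n =>
    (isLocallyConstant_vertex n).comp_continuous (by fun_prop)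
  have h2 : ∀ n, IsLocallyConstant fun p : RayPair => p.1.2.vertex n := fun n =>
    (isLocallyConstant_vertex n).comp_continuous (by fun_prop)
  have h4 := (((h1 (v.depth + 1)).prodMk (h2 (v.depth + 1))).prodMk
    ((h1 v.depth).prodMk (h2 v.depth)))
    {q | q.1.1 ≠ q.1.2 ∧ (q.2.1 = v ∨ q.2.2 = v)}
  convert h4 using 1
  ext p
  exact mem_joinSet_iff p.2 v

theorem measurableSet_lines_through (x y : Vertex) :
    MeasurableSet {ℓ : Line | x ∈ ℓ.1 ∧ y ∈ ℓ.1} :=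
  (isOpen_setOf_mem_line x).measurableSet.inter (isOpen_setOf_mem_line y).measurableSet

theorem measurable_lineOfRays : Measurable lineOfRays :=
  (continuous_coinduced_rng : Continuous lineOfRays).measurable

/-- The set of rays through the vertex `ones n`. -/
def onesCone (n : ℕ) : Set Ray := {ξ | ξ.vertex n = ones n}

theorem measurableSet_onesCone (n : ℕ) : MeasurableSet (onesCone n) :=
  (isLocallyConstant_vertex n {ones n}).measurableSet

theorem onesCone_anti {m n : ℕ} (h : m ≤ n) : onesCone n ⊆ onesCone m := by
  intro ξ hξ
  have := congrArg parent^[n - m] hξ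
  rwa [iterate_parent_vertex, iterate_parent_ones, Nat.sub_sub_self h] at this

instance : IsProbabilityMeasure rayLaw := by
  unfold rayLaw
  infer_instance

theorem initialWord_eq_replicate_iff (b : ℕ → Fin 2) (n : ℕ) :
    initialWord b n = List.replicate n 0 ↔ ∀ k ∈ Finset.range n, b k = 0 := by
  induction n with
  | zero => simp [initialWord]
  | succ n ih =>
    rw [initialWord, List.replicate_succ, List.cons.injEq, ih, Finset.range_add_one,
      Finset.forall_mem_insert]

theorem rayLaw_onesCone_succ (n : ℕ) : rayLaw.real (onesCone (n + 1)) = 1 / 3 * (1 / 2) ^ n := by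
  have h1 : onesCone (n + 1) =
      ({0} : Set (Fin 3)) ×ˢ ((Finset.range n : Set ℕ).pi fun _ => ({0} : Set (Fin 2))) := by
    ext ξ
    simp only [onesCone, Ray.vertex, ones, Set.mem_ofPred_eq, Vertex.branch.injEq,
      initialWord_eq_replicate_iff, Set.mem_prod, Set.mem_singleton_iff, Set.mem_pi,
      Finset.mem_coe]
  rw [measureReal_def, h1, rayLaw, Measure.prod_prod, Measure.infinitePi_pi _ (by simp)]
  simp [uniformOn_univ]

theorem rayLaw_onesCone_zero : rayLaw.real (onesCone 0) = 1 := by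
  have : onesCone 0 = Set.univ := Set.eq_univ_of_forall fun _ => rfl
  rw [this, probReal_univ]

theorem rayLaw_onesCone_diff (m : ℕ) :
    rayLaw.real (onesCone m \ onesCone (m + 1)) =
      rayLaw.real (onesCone m) - rayLaw.real (onesCone (m + 1)) :=
  measureReal_sdiff (onesCone_anti (Nat.le_succ m)) (measurableSet_onesCone _)

/-- The term `m = 0` is `2 / 3`, since the root has three children; for `m ≥ 1` the term is `2 ^ m /
3`. The sum is geometric. -/
theorem sum_four_pow_mul_rayLaw (i : ℕ) :
    ∑ m ∈ Finset.range (i + 1), (4 : ℝ) ^ m * rayLaw.real (onesCone m \ onesCone (m + 1)) =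
      2 / 3 * 2 ^ i := by
  induction i with
  | zero =>
    rw [Finset.sum_range_one, rayLaw_onesCone_diff, rayLaw_onesCone_zero, rayLaw_onesCone_succ]
    norm_num
  | succ i ih =>
    rw [Finset.sum_range_succ, ih, rayLaw_onesCone_diff, rayLaw_onesCone_succ,
      rayLaw_onesCone_succ]
    have h4 : (4 : ℝ) ^ i * (1 / 2) ^ i = 2 ^ i := by rw [← mul_pow]; norm_num
    rw [pow_succ, pow_succ, pow_succ]
    linear_combination (2 / 3 : ℝ) * h4

theorem mem_onesCone_diff_iff {ξ η : Ray} (h : ξ ≠ η) {m j : ℕ} (hm : m < j) (hξ : ξ ∈ onesCone j) :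
    η ∈ onesCone m \ onesCone (m + 1) ↔ meetDepth ξ η = m := by
  have h1 : ∀ k ≤ j, η ∈ onesCone k ↔ k ≤ meetDepth ξ η := fun k hk => by
    rw [← vertex_eq_iff h, show ξ.vertex k = ones k from onesCone_anti hk hξ]
    exact eq_comm
  rw [Set.mem_sdiff, h1 m hm.le, h1 (m + 1) hm]
  omega

theorem ne_of_mem_onesCone {ξ η : Ray} {m j : ℕ} (hm : m < j) (hξ : ξ ∈ onesCone j)
    (hη : η ∈ onesCone m \ onesCone (m + 1)) : ξ ≠ η := by
  rintro rfl
  exact hη.2 (onesCone_anti hm hξ)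

theorem meetDepth_comm (ξ η : Ray) : meetDepth ξ η = meetDepth η ξ := by
  simp only [meetDepth, eq_comm]

theorem rayDist_comm (ξ η : Ray) : rayDist ξ η = rayDist η ξ := by
  by_cases h : ξ = η
  · rw [h]
  · rw [rayDist, rayDist, if_neg h, if_neg (Ne.symm h), meetDepth_comm]

/-- The density of the measure on pairs of rays. -/
noncomputable def pairDensity (q : Ray × Ray) : ℝ≥0∞ := ENNReal.ofReal (1 / rayDist q.1 q.2 ^ 2)

theorem pairDensity_swap (q : Ray × Ray) : pairDensity q.swap = pairDensity q := by
  rw [pairDensity, pairDensity, Prod.fst_swap, Prod.snd_swap, rayDist_comm]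

/-- If `ξ` passes through `ones j` and `η` leaves the path of the `ones` at depth `m < j`, the two
rays separate at depth `m`, so the density is constantly `(2 ^ (-m)) ^ (-2) = 4 ^ m`. -/
theorem setLIntegral_pairDensity {m j : ℕ} (hm : m < j) :
    ∫⁻ q in onesCone j ×ˢ (onesCone m \ onesCone (m + 1)), pairDensity q ∂(rayLaw.prod rayLaw) =
      ENNReal.ofReal (rayLaw.real (onesCone j) *
        (4 ^ m * rayLaw.real (onesCone m \ onesCone (m + 1)))) := by
  have hmeas : MeasurableSet (onesCone j ×ˢ (onesCone m \ onesCone (m + 1))) :=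
    (measurableSet_onesCone j).prod ((measurableSet_onesCone m).diff (measurableSet_onesCone _))
  rw [setLIntegral_congr_fun (g := fun _ => ENNReal.ofReal (4 ^ m)) hmeas, setLIntegral_const,
    Measure.prod_prod, ← ofReal_measureReal, ← ofReal_measureReal,
    ← ENNReal.ofReal_mul (by positivity), ← ENNReal.ofReal_mul (by positivity)]
  · congr 1
    ring
  · rintro ⟨ξ, η⟩ ⟨hξ, hη⟩
    have hne := ne_of_mem_onesCone hm hξ hη
    simp only [pairDensity]
    rw [rayDist, if_neg hne, (mem_onesCone_diff_iff hne hm hξ).1 hη]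
    congr 1
    rw [← pow_mul, mul_comm m 2, pow_mul, one_div, ← inv_pow]
    norm_num

theorem setLIntegral_pairDensity_swap (A B : Set Ray) :
    ∫⁻ q in B ×ˢ A, pairDensity q ∂(rayLaw.prod rayLaw) =
      ∫⁻ q in A ×ˢ B, pairDensity q ∂(rayLaw.prod rayLaw) := by
  have hmp : MeasurePreserving (MeasurableEquiv.prodComm : Ray × Ray ≃ᵐ Ray × Ray)
      (rayLaw.prod rayLaw) (rayLaw.prod rayLaw) := Measure.measurePreserving_swap
  rw [← hmp.setLIntegral_comp_preimage_emb (MeasurableEquiv.measurableEmbedding _)]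
  have : (MeasurableEquiv.prodComm : Ray × Ray ≃ᵐ Ray × Ray) ⁻¹' B ×ˢ A = A ×ˢ B := by
    ext q
    exact and_comm
  rw [this]
  exact lintegral_congr fun q => pairDensity_swap q

/-- Pairs of rays that join into a line through `ones i` and `ones j`, where `i < j`. -/
theorem image_preimage_lines_through {i j : ℕ} (hij : i < j) :
    ((↑) : RayPair → Ray × Ray) '' (lineOfRays ⁻¹' {ℓ : Line | ones i ∈ ℓ.1 ∧ ones j ∈ ℓ.1}) =
      (⋃ m ∈ Finset.range (i + 1), onesCone j ×ˢ (onesCone m \ onesCone (m + 1))) ∪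
      ⋃ m ∈ Finset.range (i + 1), (onesCone m \ onesCone (m + 1)) ×ˢ onesCone j := by
  have key : ∀ {ξ η : Ray}, ξ ≠ η → ((ones i ∈ joinSet ξ η ∧ ones j ∈ joinSet ξ η) ↔
      meetDepth ξ η ≤ i ∧ (ξ ∈ onesCone j ∨ η ∈ onesCone j)) := by
    intro ξ η h
    rw [mem_joinSet_iff h, mem_joinSet_iff h, depth_ones, depth_ones, Ne, Ne, vertex_eq_iff h,
      vertex_eq_iff h]
    constructor
    · rintro ⟨⟨h1, -⟩, -, h2⟩
      exact ⟨by omega, h2⟩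
    · rintro ⟨h1, h2⟩
      exact ⟨⟨by omega, h2.imp (fun h => onesCone_anti hij.le h) fun h => onesCone_anti hij.le h⟩,
        by omega, h2⟩
  ext ⟨ξ, η⟩
  simp only [Set.mem_union, Set.mem_iUnion, Set.mem_prod, Finset.mem_range, exists_prop]
  constructor
  · rintro ⟨⟨q, h⟩, hp, rfl⟩
    obtain ⟨h1, h2 | h2⟩ := (key h).1 hp
    · exact Or.inl ⟨_, by omega, h2, (mem_onesCone_diff_iff h (by omega) h2).2 rfl⟩
    · rw [meetDepth_comm] at h1
      exact Or.inr ⟨_, by omega, (mem_onesCone_diff_iff h.symm (by omega) h2).2 rfl, h2⟩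
  · rintro (⟨m, hm, h1, h2⟩ | ⟨m, hm, h1, h2⟩)
    · have h := ne_of_mem_onesCone (by omega) h1 h2
      have h3 := (mem_onesCone_diff_iff h (by omega) h1).1 h2
      exact ⟨⟨(ξ, η), h⟩, (key h).2 ⟨by omega, Or.inl h1⟩, rfl⟩
    · have h := ne_of_mem_onesCone (by omega) h2 h1
      have h3 := (mem_onesCone_diff_iff h (by omega) h2).1 h1
      rw [meetDepth_comm] at h3
      exact ⟨⟨(ξ, η), h.symm⟩, (key h.symm).2 ⟨by omega, Or.inr h2⟩, rfl⟩

theorem disjoint_onesCone_diff {m n : ℕ} (h : m ≠ n) :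
    Disjoint (onesCone m \ onesCone (m + 1)) (onesCone n \ onesCone (n + 1)) := by
  refine Set.disjoint_left.2 fun ξ h1 h2 => ?_
  rcases h.lt_or_gt with h | h
  · exact h1.2 (onesCone_anti h h2.1)
  · exact h2.2 (onesCone_anti h h1.1)

theorem rayLaw_onesCone_of_pos {j : ℕ} (hj : 0 < j) :
    rayLaw.real (onesCone j) = 2 / 3 * (1 / 2) ^ j := by
  obtain ⟨k, rfl⟩ := Nat.exists_eq_succ_of_ne_zero hj.ne'
  rw [Nat.succ_eq_add_one, rayLaw_onesCone_succ, pow_succ]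
  ring

/-- One ray passes through `ones j`, with probability `2 / 3 * 2 ^ (-j)`, and the other leaves the
path at a depth at most `i`, which gives `2 / 3 * 2 ^ i` after weighting by the density. The two
orders of the pair yield `8 / 9 * 2 ^ (-(j - i))`, which the factor `9 / 8` normalises. -/
theorem lineMeasure_through {i j : ℕ} (hij : i < j) :
    lineMeasure {ℓ : Line | ones i ∈ ℓ.1 ∧ ones j ∈ ℓ.1} = ENNReal.ofReal ((1 / 2) ^ (j - i)) := by
  have hne : MeasurableSet {q : Ray × Ray | q.1 ≠ q.2} :=
    (measurableSet_eq_fun measurable_fst measurable_snd).compl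
  have hD : ∀ m, MeasurableSet (onesCone m \ onesCone (m + 1)) := fun m =>
    (measurableSet_onesCone m).diff (measurableSet_onesCone _)
  have hS := measurableSet_lines_through (ones i) (ones j)
  have hsum : ∑ m ∈ Finset.range (i + 1), ENNReal.ofReal (rayLaw.real (onesCone j) *
        (4 ^ m * rayLaw.real (onesCone m \ onesCone (m + 1)))) =
      ENNReal.ofReal (4 / 9 * (1 / 2) ^ (j - i)) := by
    rw [← ENNReal.ofReal_sum_of_nonneg (fun m _ => by positivity), ← Finset.mul_sum,
      sum_four_pow_mul_rayLaw, rayLaw_onesCone_of_pos (by omega)]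
    congr 1
    have h1 : (1 / 2 : ℝ) ^ j * 2 ^ i = (1 / 2) ^ (j - i) := by
      obtain ⟨k, rfl⟩ := Nat.exists_eq_add_of_lt hij
      rw [show i + k + 1 - i = k + 1 by omega, add_assoc, pow_add, mul_right_comm, ← mul_pow]
      norm_num
    linear_combination (4 / 9 : ℝ) * h1
  rw [lineMeasure, Measure.smul_apply, Measure.map_apply measurable_lineOfRays hS,
    withDensity_apply _ (measurable_lineOfRays hS)]
  have hint := setLIntegral_subtype (μ := rayLaw.prod rayLaw) hne
    (lineOfRays ⁻¹' {ℓ : Line | ones i ∈ ℓ.1 ∧ ones j ∈ ℓ.1}) pairDensity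
  refine (congrArg (fun a => (9 / 8 : ℝ≥0∞) • a) (hint.trans
    (congrArg (fun s => ∫⁻ q in s, pairDensity q ∂(rayLaw.prod rayLaw))
      (image_preimage_lines_through hij)))).trans ?_
  rw [lintegral_union, lintegral_biUnion_finset,
    lintegral_biUnion_finset]
  · have h1 : ∀ m ∈ Finset.range (i + 1), ∫⁻ q in onesCone j ×ˢ (onesCone m \ onesCone (m + 1)),
        pairDensity q ∂(rayLaw.prod rayLaw) = ENNReal.ofReal (rayLaw.real (onesCone j) *
        (4 ^ m * rayLaw.real (onesCone m \ onesCone (m + 1)))) := fun m hm =>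
      setLIntegral_pairDensity (by rw [Finset.mem_range] at hm; omega)
    simp_rw [setLIntegral_pairDensity_swap (onesCone j)]
    rw [Finset.sum_congr rfl h1, hsum, smul_eq_mul, ← ENNReal.ofReal_add (by positivity)
      (by positivity), show (9 / 8 : ℝ≥0∞) = ENNReal.ofReal (9 / 8) by
        rw [ENNReal.ofReal_div_of_pos (by norm_num)]; norm_num,
      ← ENNReal.ofReal_mul (by norm_num)]
    congr 1
    ring
  · exact fun m _ n _ hmn => Set.disjoint_prod.2 (Or.inl (disjoint_onesCone_diff hmn))
  · exact fun m _ => (hD m).prod (measurableSet_onesCone j)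
  · exact fun m _ n _ hmn => Set.disjoint_prod.2 (Or.inr (disjoint_onesCone_diff hmn))
  · exact fun m _ => (measurableSet_onesCone j).prod (hD m)
  · exact Finset.measurableSet_biUnion _ fun m _ => (hD m).prod (measurableSet_onesCone j)
  -- The two orders are disjoint: in one the first ray passes through `ones j`, in the other it has
  -- left the path by depth `i + 1 ≤ j`.
  · simp only [Set.disjoint_iUnion_left, Set.disjoint_iUnion_right]
    intro m hm n hn
    refine Set.disjoint_prod.2 (Or.inl (Set.disjoint_left.2 fun ξ h1 h2 =>
      h2.2 (onesCone_anti ?_ h1)))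
    rw [Finset.mem_range] at hm
    omega

/-! ### The intensity of fast roads through a segment -/

/-- Pulling back to a measurable subset commutes with countable sums of measures. This makes
`speedMeasure` s-finite, as needed to evaluate the product intensity on rectangles. -/
theorem sFinite_comap_subtype_val {α : Type*} [MeasurableSpace α] (μ : Measure α) [SFinite μ]
    {s : Set α} (hs : MeasurableSet s) : SFinite (μ.comap ((↑) : s → α)) := by
  have : μ.comap ((↑) : s → α) = Measure.sum fun n => (sfiniteSeq μ n).comap ((↑) : s → α) := by
    ext t ht
    rw [comap_subtype_coe_apply hs, Measure.sum_apply _ ht]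
    simp_rw [comap_subtype_coe_apply hs]
    conv_lhs => rw [← sum_sfiniteSeq μ]
    rw [Measure.sum_apply _ (hs.subtype_image ht)]
  rw [this]
  have : ∀ n, IsFiniteMeasure ((sfiniteSeq μ n).comap ((↑) : s → α)) := fun n =>
    ⟨by rw [comap_subtype_coe_apply hs]; exact measure_lt_top _ _⟩
  infer_instance

instance (β : ℝ) : SFinite (speedMeasure β) := by
  have := sFinite_comap_subtype_val (volume : Measure ℝ) (measurableSet_Ioi (a := (0 : ℝ)))
  unfold speedMeasure
  infer_instance

theorem speedMeasure_Ioi {β : ℝ} (hβ : 1 < β) {u : ℝ} (hu : 0 < u) :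
    speedMeasure β {v : Speed | u < v} = ENNReal.ofReal (u ^ (1 - β) / (β - 1)) := by
  have hmeas : MeasurableSet {v : Speed | u < v} :=
    measurableSet_lt measurable_const measurable_subtype_coe
  rw [speedMeasure, withDensity_apply _ hmeas]
  refine (setLIntegral_subtype measurableSet_Ioi {v : Speed | u < v}
    fun v => ENNReal.ofReal (v ^ (-β))).trans ?_
  have himg : ((↑) : Speed → ℝ) '' {v : Speed | u < v} = Set.Ioi u := by
    ext v
    exact ⟨fun ⟨w, hw, h⟩ => h ▸ hw, fun hv => ⟨⟨v, hu.trans hv⟩, hv, rfl⟩⟩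
  rw [himg, ← ofReal_integral_eq_lintegral_ofReal
    (integrableOn_Ioi_rpow_of_lt (by linarith) hu), integral_Ioi_rpow_of_lt (by linarith) hu]
  · congr 1
    rw [show -β + 1 = 1 - β by ring, show 1 - β = -(β - 1) by ring, div_neg, neg_div, neg_neg]
  · filter_upwards [ae_restrict_mem measurableSet_Ioi] with v hv
    exact Real.rpow_nonneg (hu.trans hv).le _

/-- The roads through `x` and `y` with speed greater than `u`. -/
def fastRoads (x y : Vertex) (u : ℝ) : Set Road := {r | (x ∈ r.1.1 ∧ y ∈ r.1.1) ∧ u < r.2}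

theorem fastRoads_eq_prod (x y : Vertex) (u : ℝ) :
    fastRoads x y u = {ℓ : Line | x ∈ ℓ.1 ∧ y ∈ ℓ.1} ×ˢ {v : Speed | u < v} := rfl

theorem measurableSet_fastRoads (x y : Vertex) (u : ℝ) : MeasurableSet (fastRoads x y u) := by
  rw [fastRoads_eq_prod]
  exact (measurableSet_lines_through x y).prod
    (measurableSet_lt measurable_const measurable_subtype_coe)

theorem roadIntensity_fastRoads {β : ℝ} (hβ : 1 < β) {i j : ℕ} (hij : i < j) {u : ℝ} (hu : 0 < u) :
    roadIntensity β (fastRoads (ones i) (ones j) u) =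
      ENNReal.ofReal ((1 / 2) ^ (j - i) * u ^ (1 - β)) := by
  have h1 : 0 < β - 1 := by linarith
  rw [fastRoads_eq_prod, roadIntensity, Measure.smul_apply, Measure.prod_prod,
    lineMeasure_through hij, speedMeasure_Ioi hβ hu, smul_eq_mul,
    ← ENNReal.ofReal_mul (by positivity), ← ENNReal.ofReal_mul h1.le]
  congr 1
  field_simp

/-! ### Fast driving needs fast roads -/

/-- Otherwise each edge of `U` costs at least `s / U.card`, a total of at least `s > t`. The room
between `t` and `s` is what permits a strict bound on the speed, although the supremum in
`fastestSpeed` may not be attained. -/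
theorem exists_mem_fastRoads_of_drivingDist_le {π : Set Road} {n : ℕ} {t s : ℝ} (ht : 0 < t)
    (hts : t < s) (hπ : drivingDist π root (ones n) ≤ ENNReal.ofReal t) {U : Finset ℕ}
    (hU : U ⊆ Finset.range n) (hne : U.Nonempty) :
    ∃ e ∈ U, (π ∩ fastRoads (ones e) (ones (e + 1)) (s⁻¹ * U.card)).Nonempty := by
  have hs : 0 < s := ht.trans hts
  have hc : (0 : ℝ) < U.card := by exact_mod_cast hne.card_pos
  by_contra! hcon
  have hspeed : ∀ e ∈ U, ENNReal.ofReal (s / U.card) ≤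
      (fastestSpeed π (ones e) (ones (e + 1)))⁻¹ := by
    intro e he
    rw [ENNReal.le_inv_iff_le_inv, ← ENNReal.ofReal_inv_of_pos (by positivity)]
    refine iSup₂_le fun r hr => ENNReal.ofReal_le_ofReal ?_
    by_contra! hlt
    have : r ∈ π ∩ fastRoads (ones e) (ones (e + 1)) (s⁻¹ * U.card) :=
      ⟨hr.1, hr.2, by rwa [inv_div, div_eq_inv_mul] at hlt⟩
    rw [hcon e he] at this
    exact this
  have : ENNReal.ofReal s ≤ ENNReal.ofReal t := by
    calc ENNReal.ofReal s = ∑ e ∈ U, ENNReal.ofReal (s / U.card) := by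
          rw [Finset.sum_const, nsmul_eq_mul, ← ENNReal.ofReal_natCast,
            ← ENNReal.ofReal_mul hc.le]
          congr 1
          field_simp
      _ ≤ ∑ e ∈ U, (fastestSpeed π (ones e) (ones (e + 1)))⁻¹ := Finset.sum_le_sum hspeed
      _ ≤ drivingDist π root (ones n) := by
          rw [drivingDist_root_ones]
          exact Finset.sum_le_sum_of_subset hU
      _ ≤ ENNReal.ofReal t := hπ
  rw [ENNReal.ofReal_le_ofReal_iff ht.le] at this
  linarith

theorem drivingDist_le_of_mem_fastRoads {π : Set Road} {n : ℕ} (hn : 1 ≤ n) {t : ℝ} (ht : 0 < t)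
    (hπ : (π ∩ fastRoads (ones 0) (ones n) (n / t)).Nonempty) :
    drivingDist π root (ones n) ≤ ENNReal.ofReal t := by
  obtain ⟨r, hr, ⟨h0, h1⟩, hv⟩ := hπ
  have hn' : (0 : ℝ) < n := by exact_mod_cast hn
  calc drivingDist π root (ones n)
      = ∑ k ∈ Finset.range n, (fastestSpeed π (ones k) (ones (k + 1)))⁻¹ :=
        drivingDist_root_ones π n
    _ ≤ ∑ k ∈ Finset.range n, ENNReal.ofReal (t / n) := by
        refine Finset.sum_le_sum fun k hk => ?_
        rw [Finset.mem_range] at hk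
        rw [ENNReal.inv_le_iff_inv_le, ← ENNReal.ofReal_inv_of_pos (by positivity), inv_div]
        refine (ENNReal.ofReal_le_ofReal hv.le).trans ?_
        exact le_iSup₂_of_le r ⟨hr, ones_mem_of_le r.1.2 h0 h1 (Nat.zero_le _) hk.le,
          ones_mem_of_le r.1.2 h0 h1 (Nat.zero_le _) hk⟩ le_rfl
    _ = ENNReal.ofReal t := by
        rw [Finset.sum_const, nsmul_eq_mul, Finset.card_range, ← ENNReal.ofReal_natCast,
          ← ENNReal.ofReal_mul hn'.le]
        congr 1
        field_simp

/-! ### Covering a set of edges by distinct fast roads -/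

/-- There are at most `k + 1` ways to remove an interval from a finite set of integers so that `k`
elements are left. -/
theorem sum_card_sdiff_Icc_le (U : Finset ℕ) (g : ℕ → ℝ≥0∞) :
    ∑ p ∈ (U ×ˢ U).filter (fun p => p.1 ≤ p.2), g (U \ Finset.Icc p.1 p.2).card ≤
      ∑ k ∈ Finset.range U.card, ((k : ℝ≥0∞) + 1) * g k := by
  classical
  set S := (U ×ˢ U).filter fun p => p.1 ≤ p.2 with hS
  have hmaps : ∀ p ∈ S, (U \ Finset.Icc p.1 p.2).card ∈ Finset.range U.card := by
    intro p hp
    simp only [hS, Finset.mem_filter, Finset.mem_product] at hp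
    refine Finset.mem_range.2 (Finset.card_lt_card ⟨Finset.sdiff_subset, fun h => ?_⟩)
    have := h hp.1.1
    simp [hp.2] at this
  rw [← Finset.sum_fiberwise_of_maps_to hmaps]
  refine Finset.sum_le_sum fun k _ => ?_
  rw [Finset.sum_congr rfl (g := fun _ => g k) fun p hp => by rw [(Finset.mem_filter.1 hp).2],
    Finset.sum_const, nsmul_eq_mul]
  gcongr
  have hcard : (S.filter fun p => (U \ Finset.Icc p.1 p.2).card = k).card ≤
      (Finset.range (k + 1)).card := by
    have hlt : ∀ a ∈ U, ∀ b ∈ U, a < b →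
        (U.filter (· < a)).card < (U.filter (· < b)).card := by
      intro a ha b _ hab
      refine Finset.card_lt_card ⟨fun x hx => ?_, fun h => ?_⟩
      · simp only [Finset.mem_filter] at hx ⊢
        exact ⟨hx.1, hx.2.trans hab⟩
      · have := h (Finset.mem_filter.2 ⟨ha, hab⟩)
        simp at this
    have hgt : ∀ a ∈ U, ∀ b ∈ U, a < b →
        (U.filter (b < ·)).card < (U.filter (a < ·)).card := by
      intro a _ b hb hab
      refine Finset.card_lt_card ⟨fun x hx => ?_, fun h => ?_⟩
      · simp only [Finset.mem_filter] at hx ⊢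
        exact ⟨hx.1, hab.trans hx.2⟩
      · have := h (Finset.mem_filter.2 ⟨hb, hab⟩)
        simp at this
    have hsplit : ∀ p : ℕ × ℕ, p.1 ≤ p.2 → (U \ Finset.Icc p.1 p.2).card =
        (U.filter (· < p.1)).card + (U.filter (p.2 < ·)).card := by
      intro p hp
      rw [← Finset.card_union_of_disjoint]
      · congr 1
        ext x
        simp only [Finset.mem_sdiff, Finset.mem_Icc, Finset.mem_union, Finset.mem_filter,
          ← and_or_left, and_congr_right_iff]
        omega
      · refine Finset.disjoint_left.2 fun x hx hx' => ?_
        simp only [Finset.mem_filter] at hx hx'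
        omega
    -- With `k` elements left in all, the number of elements to the left of the interval lies
    -- between `0` and `k`. It fixes the left endpoint in `U`, and the number remaining to the right
    -- then fixes the right endpoint.
    refine Finset.card_le_card_of_injOn (fun p => (U.filter (· < p.1)).card) ?_ ?_
    · intro p hp
      simp only [hS, Finset.coe_filter, Finset.mem_filter, Set.mem_ofPred_eq] at hp
      have := hsplit p hp.1.2
      simp only [Finset.coe_range, Set.mem_Iio]
      omega
    · rintro ⟨a, b⟩ hp ⟨a', b'⟩ hp' heq
      simp only [hS, Finset.coe_filter, Finset.mem_filter, Finset.mem_product,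
        Set.mem_ofPred_eq] at hp hp' heq
      obtain ⟨⟨⟨ha, hb⟩, hab⟩, hk⟩ := hp
      obtain ⟨⟨⟨ha', hb'⟩, hab'⟩, hk'⟩ := hp'
      have h1 := hsplit (a, b) hab
      have h2 := hsplit (a', b') hab'
      dsimp only at h1 h2
      have haa : a = a' := by
        rcases lt_trichotomy a a' with h | h | h
        · have := hlt a ha a' ha' h
          omega
        · exact h
        · have := hlt a' ha' a ha h
          omega
      have hbb : b = b' := by
        rcases lt_trichotomy b b' with h | h | h
        · have := hgt b hb b' hb' h
          omega
        · exact h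
        · have := hgt b' hb' b hb h
          omega
      rw [haa, hbb]
  rw [Finset.card_range] at hcard
  exact_mod_cast hcard

/-- The weight of the ways to exhaust a set of `r` consecutive edges by removing intervals, when
the removal of an interval from a set of `k` edges has weight `x k`. -/
noncomputable def removalWeight (x : ℕ → ℝ≥0∞) (r : ℕ) : ℝ≥0∞ :=
  if r = 0 then 1 else x r * ∏ k ∈ Finset.Ico 1 r, (1 + ((k : ℝ≥0∞) + 1) * x k)

/-- The term for `k ≥ 1` is the increment of the product on the right, so the sum telescopes. Thus
`removalWeight` satisfies the recursion given by the choice of the first interval to remove. -/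
theorem sum_mul_removalWeight (x : ℕ → ℝ≥0∞) {r : ℕ} (hr : 1 ≤ r) :
    ∑ k ∈ Finset.range r, ((k : ℝ≥0∞) + 1) * removalWeight x k =
      ∏ k ∈ Finset.Ico 1 r, (1 + ((k : ℝ≥0∞) + 1) * x k) := by
  induction r, hr using Nat.le_induction with
  | base => simp [removalWeight]
  | succ r hr ih =>
    rw [Finset.sum_range_succ, ih, Finset.prod_Ico_succ_top hr, removalWeight,
      if_neg (by omega)]
    ring

/-- The road passes through the edge between `ones e` and `ones (e + 1)`. -/
def Covers (r : Road) (e : ℕ) : Prop := ones e ∈ r.1.1 ∧ ones (e + 1) ∈ r.1.1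

/-- The event that there are distinct roads in the sets `A i`, none of which passes through the
edges in `U`, and that each nonempty part `V` of `U` has an edge with a road faster than
`c * V.card`. -/
def coverEvent {Ω : Type*} (Ξ : Ω → Set Road) (c : ℝ) (U : Finset ℕ) {m : ℕ}
    (A : Fin m → Set Road) : Set Ω :=
  {ω | (∃ x : Fin m → Road, Function.Injective x ∧ (∀ i, x i ∈ Ξ ω ∩ A i) ∧
      ∀ i, ∀ e ∈ U, ¬ Covers (x i) e) ∧
    ∀ V ⊆ U, V.Nonempty →
      ∃ e ∈ V, (Ξ ω ∩ fastRoads (ones e) (ones (e + 1)) (c * V.card)).Nonempty}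

/-- One removal step. The case `V = U` provides a fast road `y` through an edge of `U`; it is new,
since the roads already chosen miss `U`. The interval runs from the first to the last edge of `U` on
`y`. Edge `e` ends at `ones (e + 1)`, whence `p.2 + 1`. -/
theorem coverEvent_subset {Ω : Type*} {Ξ : Ω → Set Road} {c : ℝ} {U : Finset ℕ} (hU : U.Nonempty)
    {m : ℕ} {A : Fin m → Set Road} :
    coverEvent Ξ c U A ⊆ ⋃ p ∈ (U ×ˢ U).filter (fun p => p.1 ≤ p.2),
      coverEvent Ξ c (U \ Finset.Icc p.1 p.2)
        (Fin.cons (fastRoads (ones p.1) (ones (p.2 + 1)) (c * U.card)) A : Fin (m + 1) → Set Road) := by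
  classical
  rintro ω ⟨⟨x, hinj, hx, hxU⟩, hV⟩
  obtain ⟨e, he, y, hy, hye, hyv⟩ := hV U subset_rfl hU
  have hJ : (U.filter (Covers y)).Nonempty := ⟨e, Finset.mem_filter.2 ⟨he, hye⟩⟩
  set J := U.filter (Covers y)
  have hmin := Finset.mem_filter.1 (J.min'_mem hJ)
  have hmax := Finset.mem_filter.1 (J.max'_mem hJ)
  refine Set.mem_biUnion (x := (J.min' hJ, J.max' hJ)) ?_ ⟨⟨Fin.cons y x, ?_, ?_, ?_⟩, ?_⟩
  · exact Finset.mem_filter.2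
      ⟨Finset.mem_product.2 ⟨hmin.1, hmax.1⟩, J.min'_le _ (J.max'_mem hJ)⟩
  · refine Fin.cons_injective_iff.2 ⟨?_, hinj⟩
    rintro ⟨i, rfl⟩
    exact hxU i e he hye
  · intro i
    cases i using Fin.cases with
    | zero => exact ⟨hy, ⟨hmin.2.1, hmax.2.2⟩, hyv⟩
    | succ i => exact hx i
  · intro i a ha
    rw [Finset.mem_sdiff, Finset.mem_Icc] at ha
    cases i using Fin.cases with
    | zero =>
      intro hc
      have haJ : a ∈ J := Finset.mem_filter.2 ⟨ha.1, hc⟩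
      exact ha.2 ⟨J.min'_le a haJ, J.le_max' a haJ⟩
    | succ i => exact hxU i a ha.1
  · exact fun V hVU => hV V (hVU.trans Finset.sdiff_subset)

/-- Strong induction on the number of edges left. The sets `A i` record the roads already chosen,
and the bound on the probability of distinct points is applied only once, when no edge is left. -/
theorem measure_coverEvent_le {Ω : Type*} [MeasurableSpace Ω] {P : Measure Ω} {β : ℝ} (hβ : 1 < β)
    {Ξ : Ω → Set Road} (hΞ : IsPoissonProcess P (roadIntensity β) Ξ) {c : ℝ} (hc : 0 < c)
    (U : Finset ℕ) {m : ℕ} {A : Fin m → Set Road} (hA : ∀ i, MeasurableSet (A i)) :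
    P (coverEvent Ξ c U A) ≤ (∏ i, roadIntensity β (A i)) * (ENNReal.ofReal (1 / 2) ^ U.card *
      removalWeight (fun k => ENNReal.ofReal ((c * k) ^ (1 - β))) U.card) := by
  classical
  induction hU : U.card using Nat.strong_induction_on generalizing U m A with
  | _ r ih =>
  subst hU
  rcases U.eq_empty_or_nonempty with rfl | hne
  · simp only [Finset.card_empty, pow_zero, removalWeight, if_true, mul_one]
    refine (measure_mono ?_).trans (hΞ.measure_exists_injective_le hA)
    rintro ω ⟨⟨x, hinj, hx, -⟩, -⟩
    exact ⟨x, hinj, hx⟩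
  have hr : (0 : ℝ) < U.card := by exact_mod_cast hne.card_pos
  set w : ℕ → ℝ≥0∞ := fun k => ENNReal.ofReal ((c * k) ^ (1 - β)) with hw
  set S := (U ×ˢ U).filter fun p => p.1 ≤ p.2 with hS
  have hterm : ∀ p ∈ S, P (coverEvent Ξ c (U \ Finset.Icc p.1 p.2)
      (Fin.cons (fastRoads (ones p.1) (ones (p.2 + 1)) (c * U.card)) A : Fin (m + 1) → Set Road)) ≤
      (∏ i, roadIntensity β (A i)) * (ENNReal.ofReal (1 / 2) ^ U.card * w U.card) *
        removalWeight w (U \ Finset.Icc p.1 p.2).card := by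
    intro p hp
    simp only [hS, Finset.mem_filter, Finset.mem_product] at hp
    have hlt : (U \ Finset.Icc p.1 p.2).card < U.card := by
      refine Finset.card_lt_card ⟨Finset.sdiff_subset, fun h => ?_⟩
      have := h hp.1.1
      simp [hp.2] at this
    refine (ih _ hlt _ ?_ rfl).trans ?_
    · intro i
      cases i using Fin.cases with
      | zero => exact measurableSet_fastRoads _ _ _
      | succ i => exact hA i
    have hfast : roadIntensity β (fastRoads (ones p.1) (ones (p.2 + 1)) (c * U.card)) ≤
        ENNReal.ofReal (1 / 2) ^ (U.card - (U \ Finset.Icc p.1 p.2).card) * w U.card := by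
      rw [roadIntensity_fastRoads hβ (by omega) (by positivity), hw,
        ENNReal.ofReal_mul (by positivity), ENNReal.ofReal_pow (by positivity)]
      gcongr ?_ * _
      -- The interval may also contain edges outside `U`, so its length is only bounded below by the
      -- number of elements it removes from `U`.
      refine pow_le_pow_right_of_le_one' (ENNReal.ofReal_le_one.2 (by norm_num)) ?_
      have h1 := Finset.card_le_card_sdiff_add_card (s := U) (t := Finset.Icc p.1 p.2)
      rw [Nat.card_Icc] at h1
      omega
    rw [Fin.prod_univ_succ]
    simp only [Fin.cons_zero, Fin.cons_succ]
    calc roadIntensity β (fastRoads (ones p.1) (ones (p.2 + 1)) (c * U.card)) *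
          (∏ i, roadIntensity β (A i)) *
          (ENNReal.ofReal (1 / 2) ^ (U \ Finset.Icc p.1 p.2).card *
            removalWeight w (U \ Finset.Icc p.1 p.2).card)
        ≤ ENNReal.ofReal (1 / 2) ^ (U.card - (U \ Finset.Icc p.1 p.2).card) * w U.card *
          (∏ i, roadIntensity β (A i)) *
          (ENNReal.ofReal (1 / 2) ^ (U \ Finset.Icc p.1 p.2).card *
            removalWeight w (U \ Finset.Icc p.1 p.2).card) := by gcongr
      _ = (∏ i, roadIntensity β (A i)) * (ENNReal.ofReal (1 / 2) ^
            (U.card - (U \ Finset.Icc p.1 p.2).card + (U \ Finset.Icc p.1 p.2).card) * w U.card) *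
            removalWeight w (U \ Finset.Icc p.1 p.2).card := by
          rw [pow_add]
          ring
      _ = _ := by rw [Nat.sub_add_cancel hlt.le]
  calc P (coverEvent Ξ c U A)
      ≤ ∑ p ∈ S, P (coverEvent Ξ c (U \ Finset.Icc p.1 p.2) (Fin.cons
          (fastRoads (ones p.1) (ones (p.2 + 1)) (c * U.card)) A : Fin (m + 1) → Set Road)) :=
        (measure_mono (coverEvent_subset hne)).trans (measure_biUnion_finset_le _ _)
    _ ≤ ∑ p ∈ S, (∏ i, roadIntensity β (A i)) * (ENNReal.ofReal (1 / 2) ^ U.card * w U.card) *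
          removalWeight w (U \ Finset.Icc p.1 p.2).card := Finset.sum_le_sum hterm
    _ ≤ (∏ i, roadIntensity β (A i)) * (ENNReal.ofReal (1 / 2) ^ U.card * w U.card) *
          ∑ k ∈ Finset.range U.card, ((k : ℝ≥0∞) + 1) * removalWeight w k := by
        rw [← Finset.mul_sum]
        gcongr
        exact sum_card_sdiff_Icc_le U _
    _ = _ := by
        rw [sum_mul_removalWeight w hne.card_pos, removalWeight, if_neg hne.card_pos.ne']
        ring

/-! ### The bounds -/

section Bounds

variable {Ω : Type*} [MeasurableSpace Ω] {P : Measure Ω} {β : ℝ} {Ξ : Ω → Set Road}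

theorem measureReal_drivingDist_le_of_lt (hβ : 1 < β)
    (hΞ : IsPoissonProcess P (roadIntensity β) Ξ) {n : ℕ} (hn : 1 ≤ n) {t s : ℝ} (ht : 0 < t)
    (hts : t < s) :
    P.real {ω | drivingDist (Ξ ω) root (ones n) ≤ ENNReal.ofReal t} ≤
      (1 / 2 : ℝ) ^ n * (s / n) ^ (β - 1) *
        Real.exp (∑ k ∈ Finset.Ico 1 n, ((k : ℝ) + 1) / (k : ℝ) ^ (β - 1) * s ^ (β - 1)) := by
  have hs : 0 < s := ht.trans hts
  have hrpow : ∀ k : ℕ, (s⁻¹ * k) ^ (1 - β) = (s / k) ^ (β - 1) := fun k => by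
    rw [show 1 - β = -(β - 1) by ring, Real.rpow_neg (by positivity),
      ← Real.inv_rpow (by positivity)]
    congr 1
    rw [mul_inv, inv_inv, div_eq_mul_inv]
  have hsub : {ω | drivingDist (Ξ ω) root (ones n) ≤ ENNReal.ofReal t} ⊆
      coverEvent Ξ s⁻¹ (Finset.range n) (Fin.elim0 : Fin 0 → Set Road) := fun ω hω =>
    ⟨⟨Fin.elim0, fun i => i.elim0, fun i => i.elim0, fun i => i.elim0⟩,
      fun V hV hne => exists_mem_fastRoads_of_drivingDist_le ht hts hω hV hne⟩
  have hprod : ∏ k ∈ Finset.Ico 1 n, (1 + ((k : ℝ≥0∞) + 1) *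
      ENNReal.ofReal ((s⁻¹ * k) ^ (1 - β))) =
      ENNReal.ofReal (∏ k ∈ Finset.Ico 1 n, (1 + ((k : ℝ) + 1) * (s / k) ^ (β - 1))) := by
    rw [ENNReal.ofReal_prod_of_nonneg fun k _ => by positivity]
    refine Finset.prod_congr rfl fun k _ => ?_
    rw [hrpow, ENNReal.ofReal_add (by norm_num) (by positivity), ENNReal.ofReal_mul (by positivity),
      ENNReal.ofReal_add (by positivity) (by norm_num), ENNReal.ofReal_one, ENNReal.ofReal_natCast]
  -- All edges remain and no road has been chosen yet, so the product of intensities is empty.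
  have hle := (measure_mono hsub).trans (measure_coverEvent_le (A := Fin.elim0) hβ hΞ
    (inv_pos.2 hs) (Finset.range n) fun i => i.elim0)
  rw [Finset.card_range, removalWeight, if_neg (by omega), hprod, hrpow, Fin.prod_univ_zero, one_mul,
    ← ENNReal.ofReal_pow (by positivity), ← ENNReal.ofReal_mul (by positivity),
    ← ENNReal.ofReal_mul (by positivity)] at hle
  refine (ENNReal.toReal_le_of_le_ofReal ?_ hle).trans ?_
  · have : 0 ≤ ∏ k ∈ Finset.Ico 1 n, (1 + ((k : ℝ) + 1) * (s / k) ^ (β - 1)) :=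
      Finset.prod_nonneg fun k _ => by positivity
    positivity
  rw [← mul_assoc, Real.exp_sum]
  refine mul_le_mul_of_nonneg_left ?_ (by positivity)
  refine Finset.prod_le_prod (fun k _ => by positivity) fun k hk => ?_
  have hk : (0 : ℝ) < k := by exact_mod_cast (Finset.mem_Ico.1 hk).1
  rw [Real.div_rpow hs.le hk.le, mul_div_assoc', ← div_mul_eq_mul_div, add_comm]
  exact Real.add_one_le_exp _

/-- The probability does not involve `s`, and the bound is continuous in `s`: let `s` decrease to
`t`. -/
theorem measureReal_drivingDist_le (hβ : 1 < β) (hΞ : IsPoissonProcess P (roadIntensity β) Ξ)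
    {n : ℕ} (hn : 1 ≤ n) {t : ℝ} (ht : 0 < t) :
    P.real {ω | drivingDist (Ξ ω) root (ones n) ≤ ENNReal.ofReal t} ≤
      (1 / 2 : ℝ) ^ n * (t / n) ^ (β - 1) *
        Real.exp (∑ k ∈ Finset.Ico 1 n, ((k : ℝ) + 1) / (k : ℝ) ^ (β - 1) * t ^ (β - 1)) := by
  have hβ' : 0 ≤ β - 1 := by linarith
  have hcont : Continuous fun s : ℝ => (1 / 2 : ℝ) ^ n * (s / n) ^ (β - 1) *
      Real.exp (∑ k ∈ Finset.Ico 1 n, ((k : ℝ) + 1) / (k : ℝ) ^ (β - 1) * s ^ (β - 1)) := by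
    have h1 : Continuous fun s : ℝ => (s / n) ^ (β - 1) :=
      (continuous_id.div_const _).rpow_const fun _ => Or.inr hβ'
    have h2 : Continuous fun s : ℝ => s ^ (β - 1) := continuous_id.rpow_const fun _ => Or.inr hβ'
    fun_prop
  refine ge_of_tendsto (hcont.continuousWithinAt (s := Set.Ioi t) (x := t)) ?_
  filter_upwards [self_mem_nhdsWithin] with s hs
  exact measureReal_drivingDist_le_of_lt hβ hΞ hn ht hs

variable [IsProbabilityMeasure P]

theorem le_measureReal_drivingDist (hβ : 1 < β) (hΞ : IsPoissonProcess P (roadIntensity β) Ξ)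
    {n : ℕ} (hn : 1 ≤ n) {t : ℝ} (ht : 0 < t) :
    1 - Real.exp (-((1 / 2 : ℝ) ^ n * (t / n) ^ (β - 1))) ≤
      P.real {ω | drivingDist (Ξ ω) root (ones n) ≤ ENNReal.ofReal t} := by
  have hn' : (0 : ℝ) < n := by exact_mod_cast hn
  have hB := measurableSet_fastRoads (ones 0) (ones n) (n / t)
  have hν : roadIntensity β (fastRoads (ones 0) (ones n) (n / t)) =
      ENNReal.ofReal ((1 / 2) ^ n * (t / n) ^ (β - 1)) := by
    rw [roadIntensity_fastRoads hβ hn (by positivity), Nat.sub_zero,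
      show 1 - β = -(β - 1) by ring, Real.rpow_neg (by positivity),
      ← Real.inv_rpow (by positivity), inv_div]
  have hempty := hΞ.measure_inter_eq_empty hB (by rw [hν]; exact ENNReal.ofReal_ne_top)
  rw [hν, ENNReal.toReal_ofReal (by positivity)] at hempty
  have hreal : P.real {ω | Ξ ω ∩ fastRoads (ones 0) (ones n) (n / t) = ∅} =
      Real.exp (-((1 / 2 : ℝ) ^ n * (t / n) ^ (β - 1))) := by
    rw [measureReal_def, hempty, ENNReal.toReal_ofReal (Real.exp_pos _).le]
  rw [← hreal, ← probReal_compl_eq_one_sub (hΞ.measurableSet_inter_eq_empty hB)]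
  refine measureReal_mono fun ω hω => ?_
  exact drivingDist_le_of_mem_fastRoads hn ht (Set.nonempty_iff_ne_empty.2 hω)

theorem summable_succ_div_rpow (hβ : 3 < β) :
    Summable fun k : ℕ => ((k : ℝ) + 1) / (k : ℝ) ^ (β - 1) := by
  have h : Summable fun k : ℕ => 2 * (1 / (k : ℝ) ^ (β - 2)) :=
    (Real.summable_one_div_nat_rpow.2 (by linarith)).mul_left 2
  refine Summable.of_nonneg_of_le (fun k => by positivity) (fun k => ?_) h
  rcases Nat.eq_zero_or_pos k with rfl | hk
  -- At `k = 0` both terms are quotients by `0`, hence `0`; this term therefore adds nothing to the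
  -- series either.
  · simp [Real.zero_rpow (show β - 1 ≠ 0 by linarith), Real.zero_rpow (show β - 2 ≠ 0 by linarith)]
  · have hk' : (1 : ℝ) ≤ k := by exact_mod_cast hk
    have hk0 : (0 : ℝ) < k := by linarith
    rw [show β - 1 = (β - 2) + 1 by ring, Real.rpow_add hk0, Real.rpow_one,
      div_le_iff₀ (by positivity)]
    have hpos : 0 < (k : ℝ) ^ (β - 2) := by positivity
    field_simp
    linarith

theorem isTheta_measureReal_drivingDist (hβ : 3 < β)
    (hΞ : IsPoissonProcess P (roadIntensity β) Ξ) {t : ℝ} (ht : 0 < t) :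
    (fun n : ℕ => P.real {ω | drivingDist (Ξ ω) root (ones n) ≤ ENNReal.ofReal t})
      =Θ[Filter.atTop] fun n : ℕ => (1 / 2 : ℝ) ^ n * (t / n) ^ (β - 1) := by
  have hβ1 : 1 < β := by linarith
  have hsum := summable_succ_div_rpow hβ
  constructor
  · refine Asymptotics.IsBigO.of_bound
      (Real.exp ((∑' k : ℕ, ((k : ℝ) + 1) / (k : ℝ) ^ (β - 1)) * t ^ (β - 1))) ?_
    filter_upwards [Filter.eventually_ge_atTop 1] with n hn
    rw [Real.norm_of_nonneg measureReal_nonneg, Real.norm_of_nonneg (by positivity), mul_comm]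
    refine (measureReal_drivingDist_le hβ1 hΞ hn ht).trans ?_
    rw [← Finset.sum_mul]
    gcongr
    exact hsum.sum_le_tsum _ fun k _ => by positivity
  -- From `exp (-x) ≤ 1 / (1 + x)` follows `x ≤ (1 + x) * (1 - exp (-x))`, and here `x ≤ t ^ (β -
  -- 1)` for all `n ≥ 1`.
  · refine Asymptotics.IsBigO.of_bound (1 + t ^ (β - 1)) ?_
    filter_upwards [Filter.eventually_ge_atTop 1] with n hn
    rw [Real.norm_of_nonneg measureReal_nonneg, Real.norm_of_nonneg (by positivity)]
    have hn' : (1 : ℝ) ≤ n := by exact_mod_cast hn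
    have hlow := le_measureReal_drivingDist hβ1 hΞ hn ht
    set x := (1 / 2 : ℝ) ^ n * (t / n) ^ (β - 1)
    have hx0 : 0 ≤ x := by positivity
    have hxt : x ≤ t ^ (β - 1) := by
      calc x ≤ 1 * t ^ (β - 1) := by
            refine mul_le_mul (pow_le_one₀ (by norm_num) (by norm_num)) ?_ (by positivity)
              zero_le_one
            exact Real.rpow_le_rpow (by positivity) (div_le_self ht.le hn') (by linarith)
        _ = t ^ (β - 1) := one_mul _
    have hexp : Real.exp (-x) ≤ (1 + x)⁻¹ := by
      rw [Real.exp_neg]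
      gcongr
      linarith [Real.add_one_le_exp x]
    have hfrac : x ≤ (1 + x) * (1 - Real.exp (-x)) := by
      have : (1 + x) * (1 + x)⁻¹ = 1 := mul_inv_cancel₀ (by positivity)
      nlinarith
    have h1 : 0 ≤ 1 - Real.exp (-x) := by
      have : Real.exp (-x) ≤ 1 := Real.exp_le_one_iff.2 (by linarith)
      linarith
    calc x ≤ (1 + x) * (1 - Real.exp (-x)) := hfrac
      _ ≤ _ := mul_le_mul (by linarith) hlow h1 (by positivity)

end Bounds

end RoadTree

theorem proposition4 {Ω : Type*} [MeasurableSpace Ω] (P : Measure Ω) [IsProbabilityMeasure P]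
    (β : ℝ) (hβ : 1 < β) (Ξ : Ω → Set RoadTree.Road)
    (hΞ : RoadTree.IsPoissonProcess P (RoadTree.roadIntensity β) Ξ) :
    (∀ n : ℕ, 1 ≤ n → ∀ t : ℝ, 0 < t →
      P.real {ω | RoadTree.drivingDist (Ξ ω) RoadTree.Vertex.root (RoadTree.Vertex.ones n)
          ≤ ENNReal.ofReal t} ≤
        (1 / 2 : ℝ) ^ n * (t / n) ^ (β - 1) *
          Real.exp (∑ k ∈ Finset.Ico 1 n, ((k : ℝ) + 1) / (k : ℝ) ^ (β - 1) * t ^ (β - 1))) ∧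
    (∀ n : ℕ, 1 ≤ n → ∀ t : ℝ, 0 < t →
      1 - Real.exp (-((1 / 2 : ℝ) ^ n * (t / n) ^ (β - 1))) ≤
        P.real {ω | RoadTree.drivingDist (Ξ ω) RoadTree.Vertex.root (RoadTree.Vertex.ones n)
          ≤ ENNReal.ofReal t}) ∧
    (3 < β → ∀ t : ℝ, 0 < t →
      (fun n : ℕ => P.real {ω | RoadTree.drivingDist (Ξ ω) RoadTree.Vertex.root
          (RoadTree.Vertex.ones n) ≤ ENNReal.ofReal t})
        =Θ[Filter.atTop] fun n : ℕ => (1 / 2 : ℝ) ^ n * (t / n) ^ (β - 1)) := by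
  exact ⟨fun n hn t ht => RoadTree.measureReal_drivingDist_le hβ hΞ hn ht,
    fun n hn t ht => RoadTree.le_measureReal_drivingDist hβ hΞ hn ht,
    fun hβ' t ht => RoadTree.isTheta_measureReal_drivingDist hβ' hΞ ht⟩
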